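/- Let $P$ be a finite nonempty poset on $n \ge 1$ elements, and work in $\mathbb{R}^P \cong \mathbb{R}^n$ with standard basis vectors $\mathbf{e}_i$ ($i \in P$). For $X \subseteq P$ and $\varepsilon \in \{-1,1\}^X$ put $\mathbf{e}_X^{\varepsilon} = \sum_{i \in X} \varepsilon_i \mathbf{e}_i$ and $\mathbf{e}_X = \sum_{i \in X} \mathbf{e}_i$. The enriched order polytope $\mathcal{O}^{(e)}_P$ is the convex hull of all vectors $\mathbf{e}_{\min(F)}^{\varepsilon} + \mathbf{e}_{F \setminus \min(F)}$, where $F$ runs over the filters (upper sets) of $P$, including $\emptyset$ and $P$, $\min(F)$ is the set of minimal elements of $F$, and $\varepsilon \in \{-1,1\}^{\min(F)}$. The enriched chain polytope $\mathcal{C}^{(e)}_P$ is the convex hull of all vectors $\mathbf{e}_A^{\varepsilon}$, where $A$ runs over the antichains of $P$, including $\emptyset$, and $\varepsilon \in \{-1,1\}^{A}$. For a polytope $Q$, let $f(Q)$ denote its number of facets, i.e. of its faces of dimension $\dim Q - 1$. A saturated chain of $P$ is a nonempty chain of the form $i_0 \lessdot i_1 \lessdot \cdots \lessdot i_\ell$,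 where $\lessdot$ is the covering relation of $P$; its length is $\ell$. It is maximal if $i_0$ is a minimal element of $P$ and $i_\ell$ is a maximal element of $P$. Let $sc(P)$ be the number of saturated chains of $P$ that contain a maximal element of $P$, let $mc(P)$ be the number of maximal chains of $P$, and let $mc_\ell(P)$ be the number of maximal chains of $P$ of length $\ell$. Then: (a) $f(\mathcal{O}^{(e)}_P) = sc(P) + mc(P)$; (b) $f(\mathcal{C}^{(e)}_P) = \sum_{\ell=0}^{n-1} 2^{\ell+1}\, mc_\ell(P)$. Moreover, $f(\mathcal{O}^{(e)}_P) \le f(\mathcal{C}^{(e)}_P)$. -/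

import Mathlib

noncomputable section

namespace EnrichedPoset

variable (P : Type*)

/-- The `(-1, 0, 1)`-vector `e_X^ε = ∑_{i ∈ X} ε_i e_i` in `ℝ^P`. The sign vector is given on all
of `P`; only its values on `X` matter. -/
def signedIndicator {P : Type*} (X : Set P) (ε : P → ℤˣ) : P → ℝ :=
  X.indicator fun i => (((ε i : ℤˣ) : ℤ) : ℝ)

/-- The set `min(F)` of minimal elements of a subset `F` of `P`. -/
def minElems {P : Type*} [PartialOrder P] (F : Set P) : Set P :=
  {i | Minimal (fun j => j ∈ F) i}

/-- The enriched order polytope: the convex hull of the vectors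
`e_{F_min}^ε + e_{F_comin}`, where `F` runs over all filters (upper sets, including `∅` and `P`),
`F_min = min(F)`, `F_comin = F \ F_min`, and `ε` over all sign vectors. -/
def enrichedOrderPolytope [PartialOrder P] : Set (P → ℝ) :=
  convexHull ℝ {v | ∃ F : Set P, IsUpperSet F ∧ ∃ ε : P → ℤˣ,
    v = signedIndicator (minElems F) ε + (F \ minElems F).indicator 1}

/-- The enriched chain polytope: the convex hull of the vectors `e_A^ε`, where `A` runs over all
antichains of `P` (including `∅`) and `ε` over all sign vectors. -/
def enrichedChainPolytope [PartialOrder P] : Set (P → ℝ) :=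
  convexHull ℝ {v | ∃ A : Set P, IsAntichain (· ≤ ·) A ∧ ∃ ε : P → ℤˣ, v = signedIndicator A ε}

/-- The facets of a polytope `Q` in `ℝ^P`: the nonempty faces `F` of `Q` (the intersections of `Q`
with supporting hyperplanes) with `dim F = dim Q - 1`, where the dimension is that of the affine
hull. -/
def facets {P : Type*} (Q : Set (P → ℝ)) : Set (Set (P → ℝ)) :=
  {F | F.Nonempty ∧ IsExposed ℝ Q F ∧
    Module.finrank ℝ (vectorSpan ℝ F) + 1 = Module.finrank ℝ (vectorSpan ℝ Q)}

/-- The number of facets of a polytope. -/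
def numFacets {P : Type*} (Q : Set (P → ℝ)) : ℕ := (facets Q).ncard

/-- The (nonempty) saturated chains `i_0 ⋖ i_1 ⋖ ⋯ ⋖ i_ℓ` of `P`; `ℓ` is the length. Such a
sequence is determined by its underlying set. -/
abbrev SaturatedChain [PartialOrder P] : Type _ := RelSeries {(a, b) : P × P | a ⋖ b}

/-- A saturated chain is maximal if it starts at a minimal element of `P` and ends at a maximal
element of `P`. -/
def SaturatedChain.IsMaximal {P : Type*} [PartialOrder P] (c : SaturatedChain P) : Prop :=
  IsMin c.head ∧ IsMax c.last

/-- `sc(P)`: the number of saturated chains of `P` that contain a maximal element of `P`. -/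
def sc [PartialOrder P] : ℕ := {c : SaturatedChain P | ∃ i ∈ c, IsMax i}.ncard

/-- `mc(P)`: the number of maximal chains of `P`. -/
def mc [PartialOrder P] : ℕ := {c : SaturatedChain P | c.IsMaximal}.ncard

/-- `mc_ℓ(P)`: the number of maximal chains of `P` of length `ℓ`, i.e. with `ℓ + 1` elements. -/
def mcLength [PartialOrder P] (ℓ : ℕ) : ℕ :=
  {c : SaturatedChain P | c.IsMaximal ∧ c.length = ℓ}.ncard

end EnrichedPoset

end

/-! Both polytopes are described by finitely many inequalities `φ x ≤ 1`, indexed by chains and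
irredundant because the vertices with `φ x = 1` span the space. `numFacets_eq_ncard` then identifies
facets with functionals, and counting facets becomes counting chains.

To see that the inequalities suffice, encode `x` by a function `s` defined from the maximal elements
downwards. Let `r i` be the minimum of `s` over the covers of `i`, and 1 if there are none. For the
order polytope `s i = (x i + r i) / 2`, so `x = 2 s - r`; for the chain polytope `s i = r i - |x
i|`, so `x = σ (r - s)` with `σ` the signs of `x`. Following a cover that attains the minimum, up to
a maximal element, unrolls `s i` into a functional of a saturated chain. The inequalities then say
exactly what is needed: `s ≤ r` (automatic in the chain case), hence `s` is monotone, and `s ≥ 0` at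
minimal elements, hence everywhere.

The layer-cake formula (`layer_mem`) writes `s` and `r` as averages of indicators of `G = {s ≥ t}`
and `F = {r ≥ t}`. Here `F` is a filter containing `G`, and `F \ G` is an antichain of minimal
elements of `F`. So `2 · 1_G - 1_F` and `σ (1_F - 1_G)` are vertices, and `x` is an average of
vertices.

For the final inequality, a maximal chain with `m` elements has `m` nonempty upper parts, these
exhaust the chains counted by `sc`, and `m + 1 ≤ 2 ^ m`. -/

namespace EnrichedPoset

/-! ### Facets from irredundant inequalities -/

/-- A point of a convex set at which every functional of a finite family, each of which is bounded
by `1` on the set and somewhere smaller, is smaller than `1`. -/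
lemma exists_forall_lt_one {E : Type*} [AddCommGroup E] [Module ℝ E] {F : Set E}
    (hF : Convex ℝ F) (hne : F.Nonempty) {𝓛 : Set (Module.Dual ℝ E)} (hfin : 𝓛.Finite)
    (hle : ∀ φ ∈ 𝓛, ∀ x ∈ F, φ x ≤ 1) (hlt : ∀ φ ∈ 𝓛, ∃ x ∈ F, φ x < 1) :
    ∃ p ∈ F, ∀ φ ∈ 𝓛, φ p < 1 := by
  induction 𝓛, hfin using Set.Finite.induction_on with
  | empty => exact ⟨hne.some, hne.some_mem, by simp⟩
  | @insert φ S _ _ ih =>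
    obtain ⟨p, hp, hpS⟩ := ih (fun ψ hψ => hle ψ (Or.inr hψ)) (fun ψ hψ => hlt ψ (Or.inr hψ))
    obtain ⟨q, hq, hqφ⟩ := hlt φ (Or.inl rfl)
    refine ⟨(1 / 2 : ℝ) • p + (1 / 2 : ℝ) • q,
      hF hp hq (by norm_num) (by norm_num) (by norm_num), ?_⟩
    rintro ψ (rfl | hψ)
    · have := hle ψ (Or.inl rfl) p hp
      simp only [map_add, map_smul, smul_eq_mul]
      linarith
    · have h1 := hle ψ (Or.inr hψ) q hq
      have h2 := hpS ψ hψ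
      simp only [map_add, map_smul, smul_eq_mul]
      linarith

variable {P : Type*}

lemma finrank_vectorSpan_add_one_eq [Fintype P] {F : Set (P → ℝ)} (hne : F.Nonempty)
    {φ : Module.Dual ℝ (P → ℝ)} (hφ : ∀ x ∈ F, φ x = 1) (hspan : Submodule.span ℝ F = ⊤) :
    Module.finrank ℝ (vectorSpan ℝ F) + 1 = Fintype.card P := by
  obtain ⟨p, hp⟩ := hne
  have hφ0 : φ ≠ 0 := fun h => by simpa [h] using hφ p hp
  have hker := Module.Dual.finrank_ker_add_one_of_ne_zero hφ0
  rw [Module.finrank_fintype_fun_eq_card] at hker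
  have hle : vectorSpan ℝ F ≤ LinearMap.ker φ := by
    rw [vectorSpan_def, Submodule.span_le]
    rintro _ ⟨x, hx, y, hy, rfl⟩
    simp [hφ x hx, hφ y hy]
  have h1 := Submodule.finrank_mono hle
  have htop : (⊤ : Submodule ℝ (P → ℝ)) ≤ vectorSpan ℝ F ⊔ Submodule.span ℝ {p} := by
    rw [← hspan, Submodule.span_le]
    intro x hx
    rw [← sub_add_cancel x p]
    exact Submodule.add_mem_sup (vsub_mem_vectorSpan ℝ hx hp) (Submodule.mem_span_singleton_self p)
  have h2 := Submodule.finrank_mono htop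
  have h3 := Submodule.finrank_add_le_finrank_add_finrank (vectorSpan ℝ F) (Submodule.span ℝ {p})
  have h4 : Module.finrank ℝ (Submodule.span ℝ {p}) ≤ 1 := by
    simpa using finrank_span_le_card (R := ℝ) ({p} : Set (P → ℝ))
  rw [finrank_top, Module.finrank_fintype_fun_eq_card] at h2
  omega

/-- If a polytope is given by finitely many inequalities `φ x ≤ 1` such that the solutions of each
equation `φ x = 1` in the polytope span the space, then these inequalities correspond bijectively
to the facets. -/
theorem numFacets_eq_ncard [Fintype P] [Nonempty P] {Q : Set (P → ℝ)}
    {𝓛 : Set (Module.Dual ℝ (P → ℝ))} (hfin : 𝓛.Finite)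
    (hQ : Q = {x | ∀ φ ∈ 𝓛, φ x ≤ 1})
    (hspan : ∀ φ ∈ 𝓛, Submodule.span ℝ {x ∈ Q | φ x = 1} = ⊤) :
    numFacets Q = 𝓛.ncard := by
  have hcont : ∀ φ : Module.Dual ℝ (P → ℝ), Continuous φ := fun φ => φ.continuous_of_finiteDimensional
  have hopen : IsOpen {x : P → ℝ | ∀ φ ∈ 𝓛, φ x < 1} := by
    have : {x : P → ℝ | ∀ φ ∈ 𝓛, φ x < 1} = ⋂ φ ∈ 𝓛, {x | φ x < 1} := by ext; simp
    rw [this]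
    exact hfin.isOpen_biInter fun φ _ => isOpen_lt (hcont φ) continuous_const
  have hsub : {x : P → ℝ | ∀ φ ∈ 𝓛, φ x < 1} ⊆ Q := by
    rw [hQ]; exact fun x hx φ hφ => (hx φ hφ).le
  have hconv : Convex ℝ Q := by
    have : Q = ⋂ φ ∈ 𝓛, {x | φ x ≤ 1} := by rw [hQ]; ext; simp
    rw [this]
    exact convex_iInter₂ fun φ _ => convex_halfSpace_le φ.isLinear 1
  have hdim : Module.finrank ℝ (vectorSpan ℝ Q) = Fintype.card P := by
    have h0 : (0 : P → ℝ) ∈ interior Q :=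
      interior_maximal hsub hopen (by simp)
    have h1 := hconv.interior_nonempty_iff_affineSpan_eq_top.1 ⟨0, h0⟩
    rw [← direction_affineSpan, h1, AffineSubspace.direction_top, finrank_top,
      Module.finrank_fintype_fun_eq_card]
  have hne : ∀ φ ∈ 𝓛, {x ∈ Q | φ x = 1}.Nonempty := by
    intro φ hφ
    by_contra h
    rw [Set.not_nonempty_iff_eq_empty] at h
    have := hspan φ hφ
    rw [h, Submodule.span_empty] at this
    exact bot_ne_top this
  have himage : facets Q = (fun φ : Module.Dual ℝ (P → ℝ) => {x ∈ Q | φ x = 1}) '' 𝓛 := by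
    ext F
    constructor
    · rintro ⟨⟨p, hp⟩, hexp, hrank⟩
      obtain ⟨l, hl⟩ := hexp ⟨p, hp⟩
      have hFQ : F ⊆ Q := by rw [hl]; exact fun x hx => hx.1
      have hlp : ∀ x ∈ F, l x = l p := fun x hx => by
        have h1 := hx; have h2 := hp
        rw [hl] at h1 h2
        exact le_antisymm (h2.2 x (hFQ hx)) (h1.2 p (hFQ hp))
      have hFconv : Convex ℝ F := (hexp.convex hconv)
      by_cases h : ∃ φ ∈ 𝓛, ∀ x ∈ F, φ x = 1
      · obtain ⟨φ, hφ, hφF⟩ := h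
        refine ⟨φ, hφ, ?_⟩
        have hφ0 : φ ≠ 0 := fun h => by simpa [h] using hφF p hp
        have hker := Module.Dual.finrank_ker_add_one_of_ne_zero hφ0
        rw [Module.finrank_fintype_fun_eq_card] at hker
        have hle : vectorSpan ℝ F ≤ LinearMap.ker φ := by
          rw [vectorSpan_def, Submodule.span_le]
          rintro _ ⟨x, hx, y, hy, rfl⟩
          simp [hφF x hx, hφF y hy]
        -- By dimension `F` spans the whole direction of the hyperplane `φ = 1`, so `l`, constant on
        -- `F`, is constant on that hyperplane.
        have heq := Submodule.eq_of_le_of_finrank_eq hle (by omega)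
        have hlk : vectorSpan ℝ F ≤ LinearMap.ker (l : (P → ℝ) →ₗ[ℝ] ℝ) := by
          rw [vectorSpan_def, Submodule.span_le]
          rintro _ ⟨x, hx, y, hy, rfl⟩
          simp [hlp x hx, hlp y hy]
        apply Set.Subset.antisymm
        · rintro x ⟨hxQ, hx⟩
          have hxk : x - p ∈ LinearMap.ker φ := by simp [hx, hφF p hp]
          rw [← heq] at hxk
          have h1 : l x = l p := by
            have := hlk hxk
            simpa [sub_eq_zero] using this
          have h2 := hp
          rw [hl] at h2 ⊢
          exact ⟨hxQ, fun y hy => h1 ▸ h2.2 y hy⟩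
        · exact fun x hx => ⟨hFQ hx, hφF x hx⟩
      · exfalso
        push Not at h
        have hFle : ∀ φ ∈ 𝓛, ∀ x ∈ F, φ x ≤ 1 := fun φ hφ x hx => by
          have := hFQ hx
          rw [hQ] at this
          exact this φ hφ
        -- If no equation holds throughout `F`, then `F` contains an interior point `q` of `Q`. A
        -- linear functional maximal there is zero, which forces `F = Q`.
        obtain ⟨q, hqF, hq⟩ := exists_forall_lt_one hFconv ⟨p, hp⟩ hfin hFle
          (fun φ hφ => by
            obtain ⟨x, hx, hx1⟩ := h φ hφ
            exact ⟨x, hx, lt_of_le_of_ne (hFle φ hφ x hx) hx1⟩)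
        have hmax : IsLocalMax l q := by
          filter_upwards [hopen.mem_nhds hq] with y hy
          have h2 := hqF
          rw [hl] at h2
          exact h2.2 y (hsub hy)
        have hl0 : l = 0 := hmax.hasFDerivAt_eq_zero l.hasFDerivAt
        have : F = Q := by rw [hl]; ext; simp [hl0]
        rw [this] at hrank
        omega
    · rintro ⟨φ, hφ, rfl⟩
      refine ⟨hne φ hφ, fun _ => ⟨LinearMap.toContinuousLinearMap φ, ?_⟩, ?_⟩
      · obtain ⟨p, hpQ, hp⟩ := hne φ hφ
        have hle : ∀ y ∈ Q, φ y ≤ 1 := fun y hy => by rw [hQ] at hy; exact hy φ hφ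
        ext x
        simp only [Set.mem_ofPred_eq, LinearMap.coe_toContinuousLinearMap']
        constructor
        · rintro ⟨hx, h1⟩
          exact ⟨hx, fun y hy => h1 ▸ hle y hy⟩
        · rintro ⟨hx, h1⟩
          exact ⟨hx, le_antisymm (hle x hx) (hp ▸ h1 p hpQ)⟩
      · rw [hdim]
        exact finrank_vectorSpan_add_one_eq (hne φ hφ) (fun x hx => hx.2) (hspan φ hφ)
  rw [numFacets, himage, Set.InjOn.ncard_image]
  intro φ hφ ψ hψ h
  refine LinearMap.ext_on (hspan φ hφ) fun x hx => ?_
  have h2 : x ∈ {x ∈ Q | ψ x = 1} := by simpa only [← h] using hx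
  rw [hx.2, h2.2]

/-! ### Cover infima and the layer-cake decomposition -/

/-- The minimum of the values of `s` at the elements that cover `i`, capped by `1`. -/
noncomputable def coverInf [PartialOrder P] (s : P → ℝ) (i : P) : ℝ :=
  ⨅ o : Option {j // i ⋖ j}, o.elim 1 fun j => s j

lemma le_coverInf_iff [PartialOrder P] [Finite P] {s : P → ℝ} {i : P} {t : ℝ} :
    t ≤ coverInf s i ↔ t ≤ 1 ∧ ∀ j, i ⋖ j → t ≤ s j := by
  rw [coverInf, le_ciInf_iff (Set.finite_range _).bddBelow]
  simp [Option.forall]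

lemma coverInf_congr [PartialOrder P] {s t : P → ℝ} {i : P} (h : ∀ j, i ⋖ j → s j = t j) :
    coverInf s i = coverInf t i := by
  unfold coverInf
  congr 1
  ext (_ | j)
  · rfl
  · exact h j j.2

lemma coverInf_eq_or [PartialOrder P] [Finite P] {s : P → ℝ} {i : P} (h : ∀ j, i ⋖ j → s j ≤ 1) :
    IsMax i ∧ coverInf s i = 1 ∨ ∃ j, i ⋖ j ∧ coverInf s i = s j := by
  obtain ⟨o, ho⟩ := exists_eq_ciInf_of_finite (f := fun o : Option {j // i ⋖ j} =>
    o.elim 1 fun j => s j)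
  change _ = coverInf s i at ho
  rcases o with _ | j
  · by_cases hi : IsMax i
    · exact Or.inl ⟨hi, ho.symm⟩
    · obtain ⟨k, hk⟩ := not_isMax_iff.1 hi
      obtain ⟨j, hj, -⟩ := exists_covBy_le_of_lt hk
      refine Or.inr ⟨j, hj, ?_⟩
      have h1 : coverInf s i = 1 := ho.symm
      exact le_antisymm ((le_coverInf_iff.1 le_rfl).2 j hj) (h1 ▸ h j hj)
  · exact Or.inr ⟨j, j.2, ho.symm⟩

open MeasureTheory in
lemma setIntegral_indicator_Iic {a : ℝ} (h0 : 0 ≤ a) (h1 : a ≤ 1) :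
    ∫ t in Set.Ioc (0 : ℝ) 1, (Set.Iic a).indicator (fun _ => (1 : ℝ)) t = a := by
  rw [setIntegral_indicator measurableSet_Iic, Set.Ioc_inter_Iic, min_eq_right h1]
  simp [h0]

open MeasureTheory in
/-- The layer-cake decomposition of an order-preserving map to `[0, 1]` into indicators of upper
sets, together with its cover infima. -/
theorem layer_mem [PartialOrder P] [Fintype P] {s : P → ℝ} (hmono : Monotone s) (h0 : ∀ i, 0 ≤ s i)
    (h1 : ∀ i, s i ≤ 1) (α β : P → ℝ) {C : Set (P → ℝ)} (hconv : Convex ℝ C) (hclosed : IsClosed C)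
    (hC : ∀ G : Set P, IsUpperSet G →
      (fun i => α i * G.indicator 1 i + β i * {i | ∀ j, i ⋖ j → j ∈ G}.indicator 1 i) ∈ C) :
    (fun i => α i * s i + β i * coverInf s i) ∈ C := by
  let μ : Measure ℝ := volume.restrict (Set.Ioc 0 1)
  have hμ : IsProbabilityMeasure μ := ⟨by simp [μ]⟩
  let f : ℝ → P → ℝ := fun t i => α i * (Set.Iic (s i)).indicator (fun _ => 1) t +
    β i * (Set.Iic (coverInf s i)).indicator (fun _ => 1) t
  have hint : ∀ a : ℝ, Integrable ((Set.Iic a).indicator fun _ => (1 : ℝ)) μ := fun a =>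
    (integrable_const 1).indicator measurableSet_Iic
  have hfi : ∀ i, Integrable (fun t => f t i) μ := fun i =>
    ((hint _).const_mul _).add ((hint _).const_mul _)
  have hmem : ∀ᵐ t ∂μ, f t ∈ C := by
    refine (ae_restrict_iff' measurableSet_Ioc).2 (Filter.Eventually.of_forall fun t ht => ?_)
    have := hC {i | t ≤ s i} fun i j hij hi => le_trans hi (hmono hij)
    convert this using 3 with i
    · simp [Set.indicator]
    · have hiff : t ∈ Set.Iic (coverInf s i) ↔ ∀ j, i ⋖ j → t ≤ s j := by
        simp [le_coverInf_iff, ht.2]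
      by_cases h : ∀ j, i ⋖ j → t ≤ s j
      · rw [Set.indicator_of_mem (hiff.2 h), Set.indicator_of_mem (by exact h)]; rfl
      · rw [Set.indicator_of_notMem (fun h' => h (hiff.1 h')), Set.indicator_of_notMem (by exact h)]
  have := hconv.integral_mem hclosed hmem (Integrable.of_eval hfi)
  convert this using 1
  ext i
  have hr1 : coverInf s i ≤ 1 := (le_coverInf_iff.1 le_rfl).1
  have hr0 : 0 ≤ coverInf s i := le_coverInf_iff.2 ⟨zero_le_one, fun j _ => h0 j⟩
  rw [eval_integral hfi]
  simp only [f]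
  rw [integral_add ((hint _).const_mul _) ((hint _).const_mul _), integral_const_mul,
    integral_const_mul, setIntegral_indicator_Iic (h0 i) (h1 i), setIntegral_indicator_Iic hr0 hr1]

/-- Recursion from the maximal elements downwards along cover infima. -/
lemma exists_eq_coverInf [PartialOrder P] [Finite P] (g : P → ℝ → ℝ) :
    ∃ s : P → ℝ, ∀ i, s i = g i (coverInf s i) := by
  classical
  have hwf : WellFounded (α := P) (· > ·) := wellFounded_gt
  refine ⟨hwf.fix fun i ih => g i (coverInf (fun j => if h : j > i then ih j h else 0) i), ?_⟩
  intro i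
  rw [hwf.fix_eq]
  congr 1
  refine coverInf_congr fun j hj => ?_
  rw [dif_pos hj.lt]

open scoped Classical in
lemma submodule_eq_top_of_single [Finite P] {W : Submodule ℝ (P → ℝ)}
    (h : ∀ p, Pi.single p (1 : ℝ) ∈ W) : W = ⊤ := by
  have := Fintype.ofFinite P
  refine eq_top_iff.2 fun x _ => ?_
  rw [pi_eq_sum_univ' x]
  refine W.sum_mem fun i _ => W.smul_mem _ ?_
  convert h i using 1

/-! ### Linear functionals attached to chains -/

noncomputable section

/-- The functional `∑ 2 ^ t x_{i_t}` of a chain `i_0 > i_1 > ⋯`, listed from bottom to top. -/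
def dyadicForm : List P → Module.Dual ℝ (P → ℝ)
  | [] => 0
  | i :: L => (2 : ℝ) ^ L.length • LinearMap.proj i + dyadicForm L

/-- The functional `2 ^ k x_{i_k} - ∑_{t < k} 2 ^ t x_{i_t}` of a chain `i_0 > i_1 > ⋯ > i_k`, listed
from bottom to top. -/
def reflectedForm : List P → Module.Dual ℝ (P → ℝ)
  | [] => 0
  | i :: L => (2 : ℝ) ^ L.length • LinearMap.proj i - dyadicForm L

@[simp] lemma dyadicForm_nil (x : P → ℝ) : dyadicForm [] x = 0 := rfl

@[simp] lemma dyadicForm_cons (i : P) (L : List P) (x : P → ℝ) :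
    dyadicForm (i :: L) x = 2 ^ L.length * x i + dyadicForm L x := rfl

@[simp] lemma reflectedForm_cons (i : P) (L : List P) (x : P → ℝ) :
    reflectedForm (i :: L) x = 2 ^ L.length * x i - dyadicForm L x := rfl

lemma dyadicForm_of_forall_eq_one {L : List P} {x : P → ℝ} (h : ∀ i ∈ L, x i = 1) :
    dyadicForm L x = 2 ^ L.length - 1 := by
  induction L with
  | nil => simp
  | cons i L ih =>
    rw [dyadicForm_cons, ih fun j hj => h j (List.mem_cons_of_mem _ hj), h i (by simp),
      List.length_cons]
    ring

lemma dyadicForm_append_of_forall_eq_zero {L₁ L₂ : List P} {x : P → ℝ} (h : ∀ i ∈ L₁, x i = 0) :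
    dyadicForm (L₁ ++ L₂) x = dyadicForm L₂ x := by
  induction L₁ with
  | nil => rfl
  | cons i L ih =>
    rw [List.cons_append, dyadicForm_cons, ih fun j hj => h j (List.mem_cons_of_mem _ hj),
      h i (by simp)]
    ring

/-- The functional `∑ σ_i x_i` over a list of indices. -/
def signedForm (σ : P → ℤˣ) : List P → Module.Dual ℝ (P → ℝ)
  | [] => 0
  | i :: L => ((σ i : ℤ) : ℝ) • LinearMap.proj i + signedForm σ L

@[simp] lemma signedForm_nil (σ : P → ℤˣ) (x : P → ℝ) : signedForm σ [] x = 0 := rfl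

@[simp] lemma signedForm_cons (σ : P → ℤˣ) (i : P) (L : List P) (x : P → ℝ) :
    signedForm σ (i :: L) x = ((σ i : ℤ) : ℝ) * x i + signedForm σ L x := rfl

lemma signedForm_of_forall_eq_zero {σ : P → ℤˣ} {L : List P} {x : P → ℝ} (h : ∀ i ∈ L, x i = 0) :
    signedForm σ L x = 0 := by
  induction L with
  | nil => rfl
  | cons i L ih =>
    rw [signedForm_cons, h i (by simp), ih fun j hj => h j (List.mem_cons_of_mem _ hj)]
    ring

lemma signedForm_congr {σ τ : P → ℤˣ} {L : List P} (h : ∀ i ∈ L, σ i = τ i) :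
    signedForm σ L = signedForm τ L := by
  induction L with
  | nil => rfl
  | cons i L ih =>
    rw [signedForm, signedForm, h i (by simp), ih fun j hj => h j (List.mem_cons_of_mem _ hj)]

open scoped Classical in
lemma signedForm_single {σ : P → ℤˣ} {L : List P} (hL : L.Nodup) (p : P) :
    signedForm σ L (Pi.single p 1) = if p ∈ L then ((σ p : ℤ) : ℝ) else 0 := by
  induction L with
  | nil => simp
  | cons i L ih =>
    obtain ⟨hi, hL⟩ := List.nodup_cons.1 hL
    rw [signedForm_cons, ih hL]
    by_cases hp : p = i
    · subst hp; simp [hi]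
    · simp [hp, Ne.symm hp]

open scoped Classical in
lemma dyadicForm_single_nonneg (L : List P) (p : P) : 0 ≤ dyadicForm L (Pi.single p 1) := by
  induction L with
  | nil => simp
  | cons i L ih =>
    rw [dyadicForm_cons, Pi.single_apply]
    split_ifs <;> positivity

open scoped Classical in
lemma dyadicForm_single_pos_iff {L : List P} {p : P} :
    0 < dyadicForm L (Pi.single p 1) ↔ p ∈ L := by
  induction L with
  | nil => simp
  | cons i L ih =>
    have := dyadicForm_single_nonneg L p
    rw [dyadicForm_cons, List.mem_cons, ← ih]
    by_cases hp : p = i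
    · subst hp
      simp only [Pi.single_eq_same, mul_one, true_or, iff_true]
      positivity
    · simp [hp, Ne.symm hp]

end

/-! ### Saturated chains as lists -/

section

open scoped Classical

variable {P : Type*} [PartialOrder P]

/-- The lists that enumerate, from bottom to top, the saturated chains ending at a maximal element;
the empty list is included. -/
inductive TopChain : List P → Prop
  | nil : TopChain []
  | single {i : P} (h : IsMax i) : TopChain [i]
  | cons {i j : P} {L : List P} (h : i ⋖ j) (hL : TopChain (j :: L)) : TopChain (i :: j :: L)

/-- The lists that enumerate, from bottom to top, the maximal chains. -/
def MaxChain (L : List P) : Prop := TopChain L ∧ ∃ i ∈ L.head?, IsMin i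

lemma TopChain.tail {i : P} {L : List P} (h : TopChain (i :: L)) : TopChain L := by
  cases h with
  | single h => exact .nil
  | cons h hL => exact hL

lemma TopChain.lt {i : P} {L : List P} (h : TopChain (i :: L)) : ∀ j ∈ L, i < j := by
  induction L generalizing i with
  | nil => simp
  | cons k L ih =>
    cases h with
    | cons h hL =>
      intro j hj
      rcases List.mem_cons.1 hj with rfl | hj
      · exact h.lt
      · exact h.lt.trans (ih hL j hj)

lemma TopChain.pairwise {L : List P} (h : TopChain L) : L.Pairwise (· < ·) := by
  induction L with
  | nil => exact .nil
  | cons i L ih => exact List.pairwise_cons.2 ⟨h.lt, ih h.tail⟩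

lemma TopChain.nodup {L : List P} (h : TopChain L) : L.Nodup :=
  h.pairwise.imp fun hab => hab.ne

/-- Take `q` to be the first entry not below `p`; it exists because the chain ends at a maximal
element. If `p < q` and some entry preceded `q`, then `p` would lie strictly between consecutive
entries of a saturated chain. The split yields a filter, or an antichain, that contains `p` and
meets the chain in a controlled way. -/
lemma TopChain.exists_split {c : List P} (hc : TopChain c) (hne : c ≠ []) {p : P} (hp : p ∉ c) :
    ∃ L₁ q L₂, c = L₁ ++ q :: L₂ ∧ (∀ x ∈ L₁, x < p) ∧ ¬ q < p ∧ (p < q → L₁ = []) := by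
  induction hc with
  | nil => exact absurd rfl hne
  | @single i h => exact ⟨[], i, [], rfl, by simp, h.not_lt, fun _ => rfl⟩
  | @cons i j L h hL ih =>
    by_cases hi : i < p
    · obtain ⟨L₁, q, L₂, he, h1, h2, h3⟩ := ih (by simp) (fun h => hp (List.mem_cons_of_mem _ h))
      refine ⟨i :: L₁, q, L₂, by rw [he]; rfl, ?_, h2, fun hpq => ?_⟩
      · intro x hx
        rcases List.mem_cons.1 hx with rfl | hx
        · exact hi
        · exact h1 x hx
      · have hnil := h3 hpq
        subst hnil
        simp only [List.nil_append, List.cons.injEq] at he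
        exact absurd hpq (he.1 ▸ h.2 hi)
    · exact ⟨[], i, j :: L, rfl, by simp, hi, fun _ => rfl⟩

lemma monotone_of_le_coverInf [Finite P] {s : P → ℝ} (h : ∀ i, s i ≤ coverInf s i) :
    Monotone s := by
  have key : ∀ i j, i < j → s i ≤ s j := by
    intro i
    induction i using WellFoundedGT.induction with
    | ind i ih =>
      intro j hij
      obtain ⟨k, hk, hkj⟩ := exists_covBy_le_of_lt hij
      refine ((h i).trans ((le_coverInf_iff.1 le_rfl).2 k hk)).trans ?_
      rcases hkj.eq_or_lt with rfl | hkj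
      · exact le_rfl
      · exact ih k hk.lt j hkj
  intro i j hij
  rcases hij.eq_or_lt with rfl | hij
  · exact le_rfl
  · exact key i j hij

lemma exists_le_isMin [Finite P] (i : P) : ∃ m ≤ i, IsMin m := by
  induction i using WellFoundedLT.induction with
  | ind i ih =>
    by_cases hi : IsMin i
    · exact ⟨i, le_rfl, hi⟩
    · obtain ⟨j, hj⟩ := not_isMin_iff.1 hi
      obtain ⟨m, hm, hmin⟩ := ih j hj
      exact ⟨m, hm.trans hj.le, hmin⟩

/-! ### The enriched order polytope -/

variable (P) in
/-- The generating set of the enriched order polytope. -/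
def orderVertices : Set (P → ℝ) :=
  {v | ∃ F : Set P, IsUpperSet F ∧ ∃ ε : P → ℤˣ,
    v = signedIndicator (minElems F) ε + (F \ minElems F).indicator 1}

/-- Removes the sign vector: a vertex is a vector supported on a filter with entries `±1`, where
`-1` occurs only at minimal elements of the filter. -/
lemma mem_orderVertices_iff {v : P → ℝ} : v ∈ orderVertices P ↔ ∃ F : Set P, IsUpperSet F ∧
    (∀ i ∉ F, v i = 0) ∧ (∀ i ∈ F, v i = 1 ∨ v i = -1 ∧ ∀ j ∈ F, ¬ j < i) := by
  have hmin : ∀ (F : Set P) (i : P), i ∈ minElems F ↔ i ∈ F ∧ ∀ j ∈ F, ¬ j < i := by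
    intro F i
    exact ⟨fun h => ⟨h.1, fun j hj hji => h.not_lt hj hji⟩,
      fun h => ⟨h.1, fun j hj hji => by
        rcases hji.eq_or_lt with rfl | hlt
        · exact le_rfl
        · exact absurd hlt (h.2 j hj)⟩⟩
  constructor
  · rintro ⟨F, hF, ε, rfl⟩
    refine ⟨F, hF, fun i hi => ?_, fun i hi => ?_⟩
    · have : i ∉ minElems F := fun h => hi h.1
      simp [signedIndicator, hi, this]
    · by_cases h : i ∈ minElems F
      · rcases Int.units_eq_one_or (ε i) with hε | hε
        · left; simp [signedIndicator, h, hε]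
        · right
          exact ⟨by simp [signedIndicator, h, hε], ((hmin F i).1 h).2⟩
      · left; simp [signedIndicator, h, hi]
  · rintro ⟨F, hF, h0, h1⟩
    refine ⟨F, hF, fun i => if v i = -1 then -1 else 1, ?_⟩
    ext i
    by_cases hi : i ∈ F
    · by_cases h : i ∈ minElems F
      · rcases h1 i hi with h2 | ⟨h2, -⟩
        · have : (1 : ℝ) ≠ -1 := by norm_num
          simp [signedIndicator, h, h2, this]
        · simp [signedIndicator, h, h2]
      · rcases h1 i hi with h2 | ⟨h2, h3⟩
        · simp [signedIndicator, h, h2, hi]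
        · exact absurd ((hmin F i).2 ⟨hi, h3⟩) h
    · have : i ∉ minElems F := fun h => hi h.1
      simp [signedIndicator, hi, this, h0 i hi]

variable (P) in
/-- The functionals that define the facets of the enriched order polytope. -/
def orderForms : Set (Module.Dual ℝ (P → ℝ)) :=
  reflectedForm '' {L | TopChain L ∧ L ≠ []} ∪ (fun L => -dyadicForm L) '' {L | MaxChain L}

/-- Entries below the filter contribute 0. After the first entry in the filter all later ones equal
1, so the sum is `±2 ^ k + (2 ^ k - 1) ≥ -1`. -/
lemma TopChain.dyadicForm_nonneg {L : List P} (hL : TopChain L) {v : P → ℝ}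
    (hv : v ∈ orderVertices P) : 0 ≤ 1 + dyadicForm L v := by
  obtain ⟨F, hF, h0, h1⟩ := mem_orderVertices_iff.1 hv
  induction L with
  | nil => simp
  | cons i L ih =>
    by_cases hi : i ∈ F
    · have : ∀ j ∈ L, v j = 1 := fun j hj =>
        (h1 j (hF (hL.lt j hj).le hi)).resolve_right fun h => h.2 i hi (hL.lt j hj)
      rw [dyadicForm_cons, dyadicForm_of_forall_eq_one this]
      have h2 : (0 : ℝ) < 2 ^ L.length := by positivity
      rcases h1 i hi with h | ⟨h, -⟩ <;> rw [h] <;> linarith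
    · rw [dyadicForm_cons, h0 i hi, mul_zero, zero_add]
      exact ih hL.tail

lemma TopChain.reflectedForm_le {L : List P} (hL : TopChain L) {v : P → ℝ}
    (hv : v ∈ orderVertices P) : reflectedForm L v ≤ 1 := by
  cases L with
  | nil => simp [reflectedForm]
  | cons i L =>
    have hnn := hL.tail.dyadicForm_nonneg hv
    obtain ⟨F, hF, h0, h1⟩ := mem_orderVertices_iff.1 hv
    by_cases hi : i ∈ F
    · have : ∀ j ∈ L, v j = 1 := fun j hj =>
        (h1 j (hF (hL.lt j hj).le hi)).resolve_right fun h => h.2 i hi (hL.lt j hj)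
      rw [reflectedForm_cons, dyadicForm_of_forall_eq_one this]
      have h2 : (0 : ℝ) < 2 ^ L.length := by positivity
      rcases h1 i hi with h | ⟨h, -⟩ <;> rw [h] <;> linarith
    · rw [reflectedForm_cons, h0 i hi]
      linarith

lemma orderVertices_finite [Finite P] : (orderVertices P).Finite := by
  refine (Set.finite_range fun a : Set P × (P → ℤˣ) =>
    signedIndicator (minElems a.1) a.2 + (a.1 \ minElems a.1).indicator 1).subset ?_
  rintro _ ⟨F, -, ε, rfl⟩
  exact ⟨(F, ε), rfl⟩

lemma mem_enrichedOrderPolytope [Fintype P] {x : P → ℝ} (hx : ∀ φ ∈ orderForms P, φ x ≤ 1) :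
    x ∈ enrichedOrderPolytope P := by
  obtain ⟨s, hs⟩ := exists_eq_coverInf (P := P) fun i r => (x i + r) / 2
  have key : ∀ i, s i ≤ coverInf s i ∧
      ∃ L, TopChain (i :: L) ∧ 2 ^ (L.length + 1) * s i = 1 + dyadicForm (i :: L) x := by
    intro i
    induction i using WellFoundedGT.induction with
    | ind i ih =>
      rcases coverInf_eq_or (s := s) (i := i)
        fun j hj => (ih j hj.lt).1.trans (le_coverInf_iff.1 le_rfl).1 with ⟨hi, hr⟩ | ⟨j, hj, hr⟩
      · have h1 := hx _ (Or.inl ⟨[i], ⟨.single hi, by simp⟩, rfl⟩)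
        simp only [reflectedForm_cons, List.length_nil, dyadicForm_nil] at h1
        have h2 := hs i
        rw [hr] at h2 ⊢
        refine ⟨by linarith, [], .single hi, ?_⟩
        simp [h2]
        ring
      · obtain ⟨-, L, hL, hLs⟩ := ih j hj.lt
        have hc : TopChain (i :: j :: L) := .cons hj hL
        have h1 := hx _ (Or.inl ⟨_, ⟨hc, by simp⟩, rfl⟩)
        rw [reflectedForm_cons, List.length_cons] at h1
        have h2 := hs i
        rw [hr] at h2 ⊢
        have h3 : (0 : ℝ) < 2 ^ (L.length + 1) := by positivity
        -- By `hLs`, the inequality of the reflected form of `i :: j :: L` is `x i ≤ s j` scaled by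
        -- `2 ^ (L.length + 1)`. Hence the midpoint `s i` is at most `s j`.
        have h4 : x i ≤ s j := le_of_mul_le_mul_left (by linarith) h3
        refine ⟨by linarith, _, hc, ?_⟩
        rw [dyadicForm_cons, List.length_cons, h2, pow_succ]
        linear_combination hLs
  have hmono := monotone_of_le_coverInf fun i => (key i).1
  have h0 : ∀ i, 0 ≤ s i := by
    intro i
    obtain ⟨m, hm, hmin⟩ := exists_le_isMin i
    obtain ⟨-, L, hL, hLs⟩ := key m
    have h1 := hx _ (Or.inr ⟨m :: L, ⟨hL, m, by simp, hmin⟩, rfl⟩)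
    rw [LinearMap.neg_apply] at h1
    have h3 : (0 : ℝ) < 2 ^ (L.length + 1) := by positivity
    have h4 : 0 ≤ s m := nonneg_of_mul_nonneg_right (by linarith) h3
    exact h4.trans (hmono hm)
  -- The layer `2 · 1_G - 1_F` is 1 on `G` and `-1` on `F \ G`. An element of `F \ G` has nothing of
  -- `F` below it, since all covers of an element of `F` lie in `G`.
  have := layer_mem hmono h0 (fun i => (key i).1.trans (le_coverInf_iff.1 le_rfl).1)
    (fun _ => 2) (fun _ => -1) (convex_convexHull ℝ (orderVertices P))
    (orderVertices_finite.isClosed_convexHull ℝ) fun G hG => by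
      refine subset_convexHull ℝ _ (mem_orderVertices_iff.2
        ⟨{i | ∀ j, i ⋖ j → j ∈ G}, ?_, ?_, ?_⟩)
      · intro i k hik hi j hkj
        rcases hik.eq_or_lt with rfl | hik
        · exact hi j hkj
        · obtain ⟨l, hl, hlk⟩ := exists_covBy_le_of_lt hik
          exact hG (hlk.trans hkj.le) (hi l hl)
      · intro i hi
        have : i ∉ G := fun h => hi fun j hj => hG hj.le h
        simp [Set.indicator_of_notMem hi, this]
      · intro i hi
        rw [Set.indicator_of_mem hi]
        by_cases hiG : i ∈ G
        · left; simp [hiG]; norm_num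
        · right
          refine ⟨by simp [hiG], fun j hj hji => hiG ?_⟩
          obtain ⟨l, hl, hli⟩ := exists_covBy_le_of_lt hji
          exact hG hli (hj l hl)
  have hxs : (fun i => 2 * s i + -1 * coverInf s i) = x := by
    ext i
    have := hs i
    linarith
  rwa [hxs] at this

lemma enrichedOrderPolytope_eq [Fintype P] :
    enrichedOrderPolytope P = {x | ∀ φ ∈ orderForms P, φ x ≤ 1} := by
  apply Set.Subset.antisymm
  · refine convexHull_min (s := orderVertices P) ?_ ?_
    · rintro v hv φ (⟨L, hL, rfl⟩ | ⟨L, hL, rfl⟩)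
      · exact hL.1.reflectedForm_le hv
      · have := hL.1.dyadicForm_nonneg hv
        rw [LinearMap.neg_apply]
        linarith
    · have : {x : P → ℝ | ∀ φ ∈ orderForms P, φ x ≤ 1} = ⋂ φ ∈ orderForms P, {x | φ x ≤ 1} := by
        ext; simp
      rw [this]
      exact convex_iInter₂ fun φ _ => convex_halfSpace_le φ.isLinear 1
  · exact fun x hx => mem_enrichedOrderPolytope hx

/-- The vertices of the enriched order polytope that vanish below some element of a chain and attain
a given sign there span the space. The sign is `-1` except at the bottom of the chain, where
it is `δ`. -/
lemma TopChain.eq_top_of_orderVertices_mem [Fintype P] {c : List P} (hc : TopChain c) (hne : c ≠ [])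
    {δ : ℝ} (hδ : δ = 1 ∨ δ = -1 ∧ ∃ i ∈ c.head?, IsMin i) {W : Submodule ℝ (P → ℝ)}
    (hW : ∀ v ∈ orderVertices P, ∀ L₁ q L₂, c = L₁ ++ q :: L₂ → (∀ i ∈ L₁, v i = 0) →
      (∀ i ∈ L₂, v i = 1) → (v q = if L₁ = [] then δ else -1) → v ∈ W) :
    W = ⊤ := by
  have hδ' : δ = 1 ∨ δ = -1 := hδ.imp_right And.left
  have hsgn : ∀ L₁ : List P, (if L₁ = [] then δ else -1) = 1 ∨
      (if L₁ = [] then δ else (-1 : ℝ)) = -1 := by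
    intro L₁; split_ifs
    · exact hδ'
    · exact Or.inr rfl
  refine submodule_eq_top_of_single fun p => ?_
  induction p using WellFoundedGT.induction with
  | ind p ih =>
    by_cases hp : p ∈ c
    · obtain ⟨L₁, L₂, rfl⟩ := List.append_of_mem hp
      set δ' : ℝ := if L₁ = [] then δ else -1 with hδ''
      have hpw := List.pairwise_append.1 hc.pairwise
      have hpw2 := List.pairwise_cons.1 hpw.2.1
      -- The vertex of the principal filter of `p`; the coordinates above `p` are removed by
      -- induction.
      let v : P → ℝ := fun i => if i = p then δ' else if p < i then 1 else 0
      have hv : v ∈ W := by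
        refine hW v (mem_orderVertices_iff.2 ⟨{i | p ≤ i}, fun i j hij hi => le_trans hi hij, ?_,
          ?_⟩) L₁ p L₂ rfl ?_ ?_ (by simp [v, hδ''])
        · intro i hi
          have h1 : i ≠ p := fun h => hi (h ▸ le_refl i)
          have h2 : ¬ p < i := fun h => hi h.le
          simp [v, h1, h2]
        · intro i hi
          rcases (show p ≤ i from hi).eq_or_lt with rfl | hlt
          · rcases hsgn L₁ with h | h
            · left; simp [v, hδ'', h]
            · right
              exact ⟨by simp [v, hδ'', h], fun j hj hji => (lt_of_le_of_lt hj hji).false⟩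
          · left; simp [v, hlt, hlt.ne']
        · intro i hi
          have := hpw.2.2 i hi p (by simp)
          simp [v, this.ne, this.le.not_gt]
        · intro i hi
          have := hpw2.1 i hi
          simp [v, this, this.ne']
      have hsum : v - ∑ i ∈ Finset.univ.filter (p < ·), Pi.single i (1 : ℝ) =
          δ' • Pi.single p (1 : ℝ) := by
        ext j
        by_cases hj : j = p
        · subst hj; simp [v, Pi.single_apply]
        · by_cases hpj : p < j <;> simp [v, Pi.single_apply, hj, hpj]
      have hmem : δ' • Pi.single p (1 : ℝ) ∈ W := by
        rw [← hsum]
        exact W.sub_mem hv (W.sum_mem fun i hi => ih i (Finset.mem_filter.1 hi).2)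
      have hδ0 : δ' ≠ 0 := by rcases hsgn L₁ with h | h <;> rw [hδ'', h] <;> norm_num
      exact (W.smul_mem_iff hδ0).1 hmem
    · obtain ⟨L₁, q, L₂, rfl, h1, h2, h3⟩ := hc.exists_split hne hp
      set δ' : ℝ := if L₁ = [] then δ else -1 with hδ''
      have hpw := List.pairwise_append.1 hc.pairwise
      have hpw2 := List.pairwise_cons.1 hpw.2.1
      have hqp : q ≠ p := fun h => hp (by simp [h])
      have hqδ : p < q → δ' = 1 := by
        intro hpq
        have hnil := h3 hpq
        subst hnil
        rcases hδ with h | ⟨-, i, hi, hmin⟩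
        · simp [hδ'', h]
        · simp only [List.nil_append, List.head?_cons, Option.mem_some_iff] at hi
          subst hi
          exact absurd hpq hmin.not_lt
      -- The vertex of the filter generated by `p` and `q`. As `q` is not below `p`, the sign `a` at
      -- `p` is free, and the two choices differ by twice the basis vector at `p`.
      let v : ℝ → P → ℝ := fun a i =>
        if i = p then a else if i = q then δ' else if p < i ∨ q < i then 1 else 0
      have hv : ∀ a, a = 1 ∨ a = -1 → v a ∈ W := by
        intro a ha
        refine hW (v a) (mem_orderVertices_iff.2 ⟨{i | p ≤ i ∨ q ≤ i}, ?_, ?_, ?_⟩) L₁ q L₂ rfl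
          ?_ ?_ (by simp [v, hδ'', hqp])
        · exact fun i j hij hi => hi.imp (fun h => h.trans hij) fun h => h.trans hij
        · intro i hi
          have h4 : ¬ (p ≤ i ∨ q ≤ i) := hi
          push Not at h4
          have h5 : i ≠ p := fun h => h4.1 h.ge
          have h6 : i ≠ q := fun h => h4.2 h.ge
          have h7 : ¬ p < i := fun h => h4.1 h.le
          have h8 : ¬ q < i := fun h => h4.2 h.le
          simp [v, h5, h6, h7, h8]
        · intro i hi
          by_cases hip : i = p
          · subst hip
            rcases ha with rfl | rfl
            · left; simp [v]
            · right
              refine ⟨by simp [v], fun j hj hji => ?_⟩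
              rcases hj with hj | hj
              · exact (lt_of_le_of_lt hj hji).false
              · exact h2 (lt_of_le_of_lt hj hji)
          · by_cases hiq : i = q
            · subst hiq
              rcases hsgn L₁ with h | h
              · left; simp [v, hδ'', hqp, h]
              · right
                refine ⟨by simp [v, hδ'', hqp, h], fun j hj hji => ?_⟩
                rcases hj with hj | hj
                · have := hqδ (lt_of_le_of_lt hj hji)
                  rw [hδ'', h] at this
                  norm_num at this
                · exact (lt_of_le_of_lt hj hji).false
            · left
              have : p < i ∨ q < i := hi.imp (fun h => lt_of_le_of_ne h (Ne.symm hip))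
                fun h => lt_of_le_of_ne h (Ne.symm hiq)
              simp [v, hip, hiq, this]
        · intro i hi
          have h5 := h1 i hi
          have h6 := hpw.2.2 i hi q (by simp)
          simp [v, h5.ne, h6.ne, h5.le.not_gt, h6.le.not_gt]
        · intro i hi
          have h5 := hpw2.1 i hi
          have h6 : i ≠ p := fun h => hp (by simp [← h, hi])
          simp [v, h5, h5.ne', h6]
      have hdiff : v 1 - v (-1) = (2 : ℝ) • Pi.single p (1 : ℝ) := by
        ext j
        by_cases hj : j = p
        · subst hj; simp [v]; norm_num
        · simp [v, hj]
      have hmem := W.sub_mem (hv 1 (Or.inl rfl)) (hv (-1) (Or.inr rfl))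
      rw [hdiff] at hmem
      exact (W.smul_mem_iff two_ne_zero).1 hmem

/-- Tightness comes from `2 ^ k - (2 ^ k - 1) = 1`. The entry at `q` must be `-1` for either form,
except at the bottom of a reflected form, where it must be 1. -/
lemma span_orderForm_eq [Fintype P] {φ : Module.Dual ℝ (P → ℝ)} (hφ : φ ∈ orderForms P) :
    Submodule.span ℝ {x ∈ enrichedOrderPolytope P | φ x = 1} = ⊤ := by
  have hsub : ∀ v ∈ orderVertices P, v ∈ enrichedOrderPolytope P := fun v hv =>
    subset_convexHull ℝ (orderVertices P) hv
  rcases hφ with ⟨L, ⟨hL, hne⟩, rfl⟩ | ⟨L, hL, rfl⟩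
  · refine hL.eq_top_of_orderVertices_mem hne (Or.inl rfl) fun v hv L₁ q L₂ hc h0 h1 hq =>
      Submodule.subset_span ⟨hsub v hv, ?_⟩
    rcases L₁ with _ | ⟨i, L₁⟩
    · rw [hc, List.nil_append, reflectedForm_cons, dyadicForm_of_forall_eq_one h1, hq]
      simp
    · rw [hc, List.cons_append, reflectedForm_cons, h0 i (by simp),
        dyadicForm_append_of_forall_eq_zero fun j hj => h0 j (List.mem_cons_of_mem _ hj),
        dyadicForm_cons, dyadicForm_of_forall_eq_one h1, hq]
      simp
  · have hne : L ≠ [] := by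
      rintro rfl
      obtain ⟨i, hi, -⟩ := hL.2
      simp at hi
    refine hL.1.eq_top_of_orderVertices_mem hne (Or.inr ⟨rfl, hL.2⟩) fun v hv L₁ q L₂ hc h0 h1 hq =>
      Submodule.subset_span ⟨hsub v hv, ?_⟩
    rw [LinearMap.neg_apply, hc, dyadicForm_append_of_forall_eq_zero h0, dyadicForm_cons,
      dyadicForm_of_forall_eq_one h1, hq]
    simp

/-! ### The enriched chain polytope -/

variable (P) in
/-- The generating set of the enriched chain polytope. -/
def chainVertices : Set (P → ℝ) :=
  {v | ∃ A : Set P, IsAntichain (· ≤ ·) A ∧ ∃ ε : P → ℤˣ, v = signedIndicator A ε}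

lemma mem_chainVertices_iff {v : P → ℝ} : v ∈ chainVertices P ↔
    (∀ i, v i = 0 ∨ v i = 1 ∨ v i = -1) ∧ ∀ i j, v i ≠ 0 → v j ≠ 0 → ¬ i < j := by
  constructor
  · rintro ⟨A, hA, ε, rfl⟩
    have hmem : ∀ i, signedIndicator A ε i ≠ 0 → i ∈ A := fun i h =>
      by_contra fun hi => h (Set.indicator_of_notMem hi _)
    refine ⟨fun i => ?_, fun i j hi hj hij => hA (hmem i hi) (hmem j hj) hij.ne hij.le⟩
    by_cases hi : i ∈ A
    · rcases Int.units_eq_one_or (ε i) with h | h <;> simp [signedIndicator, hi, h]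
    · left; simp [signedIndicator, hi]
  · rintro ⟨h1, h2⟩
    refine ⟨{i | v i ≠ 0}, fun i hi j hj hij hle => h2 i j hi hj (lt_of_le_of_ne hle hij),
      fun i => if v i = -1 then -1 else 1, ?_⟩
    ext i
    have : (1 : ℝ) ≠ -1 := by norm_num
    rcases h1 i with h | h | h <;> simp [signedIndicator, Set.indicator, h, this]

lemma chainVertices_finite [Finite P] : (chainVertices P).Finite := by
  refine (Set.finite_range fun a : Set P × (P → ℤˣ) => signedIndicator a.1 a.2).subset ?_
  rintro _ ⟨F, -, ε, rfl⟩
  exact ⟨(F, ε), rfl⟩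

variable (P) in
/-- The functionals that define the facets of the enriched chain polytope. -/
def chainForms : Set (Module.Dual ℝ (P → ℝ)) :=
  {φ | ∃ L σ, MaxChain L ∧ φ = signedForm σ L}

/-- An antichain meets a chain in at most one element. -/
lemma TopChain.signedForm_le {L : List P} (hL : TopChain L) (σ : P → ℤˣ) {v : P → ℝ}
    (hv : v ∈ chainVertices P) : signedForm σ L v ≤ 1 := by
  obtain ⟨h1, h2⟩ := mem_chainVertices_iff.1 hv
  induction L with
  | nil => simp
  | cons i L ih =>
    rw [signedForm_cons]
    by_cases hi : v i = 0
    · rw [hi, mul_zero, zero_add]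
      exact ih hL.tail
    · rw [signedForm_of_forall_eq_zero fun j hj => by_contra fun h => h2 i j hi h (hL.lt j hj)]
      rcases h1 i with h | h | h <;> rcases Int.units_eq_one_or (σ i) with h' | h' <;>
        simp [h, h']

lemma mem_enrichedChainPolytope [Fintype P] {x : P → ℝ} (hx : ∀ φ ∈ chainForms P, φ x ≤ 1) :
    x ∈ enrichedChainPolytope P := by
  obtain ⟨s, hs⟩ := exists_eq_coverInf (P := P) fun i r => r - |x i|
  let σ : P → ℤˣ := fun i => if 0 ≤ x i then 1 else -1
  have hσ : ∀ i, ((σ i : ℤ) : ℝ) * x i = |x i| := by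
    intro i
    by_cases h : 0 ≤ x i
    · simp [σ, h, abs_of_nonneg]
    · simp [σ, h, abs_of_neg (not_le.1 h)]
  have hle : ∀ i, s i ≤ coverInf s i := fun i => by
    have := hs i
    have := abs_nonneg (x i)
    linarith
  have key : ∀ i, ∃ L, TopChain (i :: L) ∧ s i = 1 - signedForm σ (i :: L) x := by
    intro i
    induction i using WellFoundedGT.induction with
    | ind i ih =>
      rcases coverInf_eq_or (s := s) (i := i)
        fun j _ => (hle j).trans (le_coverInf_iff.1 le_rfl).1 with ⟨hi, hr⟩ | ⟨j, hj, hr⟩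
      · refine ⟨[], .single hi, ?_⟩
        rw [hs i, hr, signedForm_cons, hσ]
        simp
      · obtain ⟨L, hL, hLs⟩ := ih j hj.lt
        refine ⟨_, .cons hj hL, ?_⟩
        rw [hs i, hr, signedForm_cons, hσ, hLs]
        ring
  have hmono := monotone_of_le_coverInf hle
  have h0 : ∀ i, 0 ≤ s i := by
    intro i
    obtain ⟨m, hm, hmin⟩ := exists_le_isMin i
    obtain ⟨L, hL, hLs⟩ := key m
    have h1 := hx _ ⟨m :: L, σ, ⟨hL, m, by simp, hmin⟩, rfl⟩
    have := hmono hm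
    linarith
  -- The layer is `σ (1_F - 1_G)`, supported on the antichain `F \ G`.
  have := layer_mem hmono h0 (fun i => (hle i).trans (le_coverInf_iff.1 le_rfl).1)
    (fun i => -((σ i : ℤ) : ℝ)) (fun i => ((σ i : ℤ) : ℝ)) (convex_convexHull ℝ (chainVertices P))
    (chainVertices_finite.isClosed_convexHull ℝ) fun G hG => by
      refine subset_convexHull ℝ _ (mem_chainVertices_iff.2 ⟨fun i => ?_, fun i j hi hj hij => ?_⟩)
      · by_cases h1 : i ∈ G
        · have h2 : i ∈ {i | ∀ j, i ⋖ j → j ∈ G} := fun k hk => hG hk.le h1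
          rw [Set.indicator_of_mem h1, Set.indicator_of_mem h2]
          left; ring
        · rw [Set.indicator_of_notMem h1, mul_zero, zero_add]
          by_cases h2 : i ∈ {i | ∀ j, i ⋖ j → j ∈ G}
          · rw [Set.indicator_of_mem h2]
            rcases Int.units_eq_one_or (σ i) with h | h <;> simp [h]
          · left; rw [Set.indicator_of_notMem h2, mul_zero]
      · have hjG : j ∉ G := by
          intro h
          have h' : j ∈ {i | ∀ j, i ⋖ j → j ∈ G} := fun k hk => hG hk.le h
          exact hj (by rw [Set.indicator_of_mem h, Set.indicator_of_mem h']; ring)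
        have hiG : i ∉ G := fun h => hjG (hG hij.le h)
        have hicov : ∀ k, i ⋖ k → k ∈ G := by
          by_contra h
          exact hi (by rw [Set.indicator_of_notMem hiG, Set.indicator_of_notMem (by exact h)]; ring)
        obtain ⟨k, hk, hkj⟩ := exists_covBy_le_of_lt hij
        exact hjG (hG hkj (hicov k hk))
  have hxs : (fun i => -((σ i : ℤ) : ℝ) * s i + ((σ i : ℤ) : ℝ) * coverInf s i) = x := by
    ext i
    have h1 : ((σ i : ℤ) : ℝ) * ((σ i : ℤ) : ℝ) = 1 := by
      rcases Int.units_eq_one_or (σ i) with h | h <;> simp [h]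
    rw [hs i, ← hσ i]
    linear_combination x i * h1
  rwa [hxs] at this

lemma enrichedChainPolytope_eq [Fintype P] :
    enrichedChainPolytope P = {x | ∀ φ ∈ chainForms P, φ x ≤ 1} := by
  apply Set.Subset.antisymm
  · refine convexHull_min (s := chainVertices P) ?_ ?_
    · rintro v hv φ ⟨L, σ, hL, rfl⟩
      exact hL.1.signedForm_le σ hv
    · have : {x : P → ℝ | ∀ φ ∈ chainForms P, φ x ≤ 1} = ⋂ φ ∈ chainForms P, {x | φ x ≤ 1} := by
        ext; simp
      rw [this]
      exact convex_iInter₂ fun φ _ => convex_halfSpace_le φ.isLinear 1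
  · exact fun x hx => mem_enrichedChainPolytope hx

lemma span_chainForm_eq [Fintype P] {φ : Module.Dual ℝ (P → ℝ)} (hφ : φ ∈ chainForms P) :
    Submodule.span ℝ {x ∈ enrichedChainPolytope P | φ x = 1} = ⊤ := by
  obtain ⟨c, σ, hc, rfl⟩ := hφ
  set W := Submodule.span ℝ {x ∈ enrichedChainPolytope P | signedForm σ c x = 1}
  have hW : ∀ v ∈ chainVertices P, signedForm σ c v = 1 → v ∈ W := fun v hv h =>
    Submodule.subset_span ⟨subset_convexHull ℝ (chainVertices P) hv, h⟩
  have hσ0 : ∀ q, ((σ q : ℤ) : ℝ) = 1 ∨ ((σ q : ℤ) : ℝ) = -1 := fun q => by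
    rcases Int.units_eq_one_or (σ q) with h | h <;> simp [h]
  have hσσ : ∀ q, ((σ q : ℤ) : ℝ) * ((σ q : ℤ) : ℝ) = 1 := fun q => by
    rcases hσ0 q with h | h <;> rw [h] <;> norm_num
  have hchain : ∀ q ∈ c, Pi.single q (1 : ℝ) ∈ W := by
    intro q hq
    have : ((σ q : ℤ) : ℝ) • Pi.single q (1 : ℝ) ∈ W := by
      refine hW _ (mem_chainVertices_iff.2 ⟨fun i => ?_, fun i j hi hj => ?_⟩) ?_
      · by_cases h : i = q
        · subst h; right; simpa only [Pi.smul_apply, Pi.single_eq_same, smul_eq_mul, mul_one] using hσ0 i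
        · simp [h]
      · have hi' : i = q := by
          by_contra h; simp [h] at hi
        have hj' : j = q := by
          by_contra h; simp [h] at hj
        rw [hi', hj']; exact lt_irrefl q
      · rw [map_smul, signedForm_single hc.1.nodup, if_pos hq, smul_eq_mul, hσσ]
    refine (W.smul_mem_iff ?_).1 this
    rcases hσ0 q with h | h <;> rw [h] <;> norm_num
  refine submodule_eq_top_of_single fun p => ?_
  by_cases hp : p ∈ c
  · exact hchain p hp
  have hne : c ≠ [] := by
    rintro rfl
    obtain ⟨i, hi, -⟩ := hc.2
    simp at hi
  obtain ⟨L₁, q, L₂, rfl, -, hqp, hpq⟩ := hc.1.exists_split hne hp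
  have hpq' : ¬ p < q := by
    intro h
    obtain rfl := hpq h
    obtain ⟨i, hi, hmin⟩ := hc.2
    simp only [List.nil_append, List.head?_cons, Option.mem_some_iff] at hi
    subst hi
    exact hmin.not_lt h
  have hne' : p ≠ q := fun h => hp (by simp [h])
  -- The elements `p` and `q` are incomparable, so this is a vertex, and it is tight because of its
  -- entry at `q`.
  have hmem : Pi.single p (1 : ℝ) + ((σ q : ℤ) : ℝ) • Pi.single q (1 : ℝ) ∈ W := by
    refine hW _ (mem_chainVertices_iff.2 ⟨fun i => ?_, ?_⟩) ?_
    · by_cases h : i = q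
      · subst h
        right
        simpa only [Pi.add_apply, Pi.smul_apply, Pi.single_eq_same, Pi.single_eq_of_ne hne'.symm,
          smul_eq_mul, mul_one, zero_add] using hσ0 i
      · by_cases h' : i = p
        · subst h'; simp [h]
        · simp [h, h']
    · have : ∀ i, (Pi.single p (1 : ℝ) + ((σ q : ℤ) : ℝ) • Pi.single q (1 : ℝ) : P → ℝ) i ≠ 0 →
          i = p ∨ i = q := by
        intro i hi
        by_contra h
        push Not at h
        simp [h.1, h.2] at hi
      intro i j hi hj
      rcases this i hi with rfl | rfl <;> rcases this j hj with rfl | rfl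
      · exact lt_irrefl _
      · exact hpq'
      · exact hqp
      · exact lt_irrefl _
    · rw [map_add, map_smul, signedForm_single hc.1.nodup, signedForm_single hc.1.nodup, if_neg hp,
        if_pos (by simp), smul_eq_mul, hσσ, zero_add]
  have := W.sub_mem hmem (W.smul_mem ((σ q : ℤ) : ℝ) (hchain q (by simp)))
  rwa [add_sub_cancel_right] at this

/-! ### Counting -/

lemma finite_topChain [Fintype P] : {L : List P | TopChain L}.Finite :=
  have : Finite {L : List P | L.Nodup} := inferInstanceAs (Finite {L : List P // L.Nodup})
  (Set.toFinite {L : List P | L.Nodup}).subset fun _ h => h.nodup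

lemma finite_maxChain [Fintype P] : {L : List P | MaxChain L}.Finite :=
  finite_topChain.subset fun _ h => h.1

lemma finite_orderForms [Fintype P] : (orderForms P).Finite :=
  ((finite_topChain.subset fun _ h => h.1).image _).union (finite_maxChain.image _)

lemma finite_chainForms [Fintype P] : (chainForms P).Finite := by
  refine ((finite_maxChain (P := P)).prod (Set.finite_univ (α := P → ℤˣ)) |>.image
    fun a => signedForm a.2 a.1).subset ?_
  rintro _ ⟨L, σ, hL, rfl⟩
  exact ⟨(L, σ), ⟨hL, trivial⟩, rfl⟩

lemma TopChain.ext {L M : List P} (hL : TopChain L) (hM : TopChain M)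
    (h : ∀ i, i ∈ L ↔ i ∈ M) : L = M :=
  ((List.perm_ext_iff_of_nodup hL.nodup hM.nodup).2 h).eq_of_pairwise
    (fun _ _ _ _ hab hba => absurd hba hab.not_gt) hL.pairwise hM.pairwise

lemma injOn_dyadicForm : Set.InjOn (dyadicForm (P := P)) {L | TopChain L} := by
  intro L hL M hM h
  refine hL.ext hM fun i => ?_
  rw [← dyadicForm_single_pos_iff, h, dyadicForm_single_pos_iff]

/-- The signs of the coefficients recover the chain: the only positive one is at the bottom, the
negative ones at the rest. This also separates reflected forms from negated dyadic forms. -/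
lemma TopChain.reflectedForm_single {i : P} {L : List P} (h : TopChain (i :: L)) (p : P) :
    (0 < reflectedForm (i :: L) (Pi.single p 1) ↔ p = i) ∧
    (reflectedForm (i :: L) (Pi.single p 1) < 0 ↔ p ∈ L) := by
  have h1 := dyadicForm_single_nonneg L p
  have h2 := dyadicForm_single_pos_iff (L := L) (p := p)
  have h3 : (0 : ℝ) < 2 ^ L.length := by positivity
  rw [reflectedForm_cons]
  by_cases hp : p = i
  · subst hp
    have h4 : p ∉ L := fun hp => (h.lt p hp).false
    have h5 : dyadicForm L (Pi.single p 1) = 0 := le_antisymm (not_lt.1 fun h => h4 (h2.1 h)) h1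
    simp [h4, h5, h3.le]
  · simp [hp, h2, h1]

lemma injOn_reflectedForm : Set.InjOn (reflectedForm (P := P)) {L | TopChain L ∧ L ≠ []} := by
  rintro (_ | ⟨i, L⟩) ⟨hL, hL'⟩ M ⟨hM, hM'⟩ h
  · exact absurd rfl hL'
  rcases M with _ | ⟨j, M⟩
  · exact absurd rfl hM'
  have hij : i = j := ((hM.reflectedForm_single i).1.1 (h ▸ (hL.reflectedForm_single i).1.2 rfl))
  subst hij
  congr 1
  refine hL.tail.ext hM.tail fun p => ?_
  rw [← (hL.reflectedForm_single p).2, h, (hM.reflectedForm_single p).2]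

lemma ncard_orderForms [Fintype P] : (orderForms P).ncard =
    {L : List P | TopChain L ∧ L ≠ []}.ncard + {L : List P | MaxChain L}.ncard := by
  rw [orderForms, Set.ncard_union_eq ?_ ((finite_topChain.subset fun _ h => h.1).image _)
    (finite_maxChain.image _), injOn_reflectedForm.ncard_image, Set.InjOn.ncard_image]
  · exact fun L hL M hM h => injOn_dyadicForm hL.1 hM.1 (neg_injective h)
  · rw [Set.disjoint_left]
    rintro _ ⟨L, ⟨hL, hne⟩, rfl⟩ ⟨M, hM, h⟩
    rcases L with _ | ⟨i, L⟩
    · exact hne rfl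
    have h1 := (hL.reflectedForm_single i).1.2 rfl
    rw [← h] at h1
    have h2 := dyadicForm_single_nonneg M i
    simp only [LinearMap.neg_apply] at h1
    linarith

lemma ncard_chainForms [Fintype P] :
    (chainForms P).ncard = ∑ L ∈ (finite_maxChain (P := P)).toFinset, 2 ^ L.length := by
  -- Signs are indexed by the entries of the chain only, since values of `σ` off the chain do not
  -- change the functional.
  let ι := Σ L : {L : List P // MaxChain L}, ({i // i ∈ L.1} → ℤˣ)
  have : Fintype {L : List P // MaxChain L} := (finite_maxChain (P := P)).fintype
  let ext : ∀ L : List P, ({i // i ∈ L} → ℤˣ) → P → ℤˣ :=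
    fun L τ i => if h : i ∈ L then τ ⟨i, h⟩ else 1
  let f : ι → Module.Dual ℝ (P → ℝ) := fun a => signedForm (ext a.1.1 a.2) a.1.1
  have hunit : ∀ u : ℤˣ, ((u : ℤ) : ℝ) ≠ 0 := fun u => by
    rcases Int.units_eq_one_or u with h | h <;> simp [h]
  have hinj : Function.Injective f := by
    rintro ⟨⟨L, hL⟩, τ⟩ ⟨⟨M, hM⟩, ρ⟩ h
    have happ : ∀ i, signedForm (ext L τ) L (Pi.single i 1) =
        signedForm (ext M ρ) M (Pi.single i 1) := fun i => DFunLike.congr_fun h _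
    simp only [signedForm_single hL.1.nodup, signedForm_single hM.1.nodup] at happ
    have hLM : L = M := hL.1.ext hM.1 fun i => by
      have := happ i
      by_cases h1 : i ∈ L <;> by_cases h2 : i ∈ M
      · simp [h1, h2]
      · simp only [h1, h2, if_true, if_false] at this; exact absurd this (hunit _)
      · simp only [h1, h2, if_true, if_false] at this; exact absurd this.symm (hunit _)
      · simp [h1, h2]
    subst hLM
    have hτ : τ = ρ := by
      ext ⟨i, hi⟩
      have := happ i
      simp only [hi, if_true, ext, dif_pos] at this
      exact_mod_cast this
    rw [hτ]
  have himage : chainForms P = Set.range f := by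
    ext φ
    constructor
    · rintro ⟨L, σ, hL, rfl⟩
      refine ⟨⟨⟨L, hL⟩, fun i => σ i⟩, ?_⟩
      exact signedForm_congr fun i hi => by simp [ext, hi]
    · rintro ⟨⟨⟨L, hL⟩, τ⟩, rfl⟩
      exact ⟨L, _, hL, rfl⟩
  rw [himage, ← Set.image_univ, hinj.injOn.ncard_image, Set.ncard_univ, Nat.card_sigma]
  rw [Finset.sum_subtype (finite_maxChain (P := P)).toFinset (p := MaxChain)
    fun L => finite_maxChain.mem_toFinset]
  refine Fintype.sum_congr _ _ ?_
  rintro ⟨L, hL⟩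
  have hcard : Nat.card {i // i ∈ L} = L.length := by
    rw [← List.toFinset_card_of_nodup hL.1.nodup, Nat.card_eq_fintype_card, Fintype.card_subtype]
    congr 1
    ext
    simp
  rw [Nat.card_fun, hcard]
  simp

/-- The saturated chains that end at a maximal element are the upper parts of maximal chains. -/
lemma TopChain.exists_maxChain [Finite P] {L : List P} (hL : TopChain L) (hne : L ≠ []) :
    ∃ M, MaxChain (M ++ L) := by
  obtain ⟨i, L, rfl⟩ := List.exists_cons_of_ne_nil hne
  clear hne
  induction i using WellFoundedLT.induction generalizing L with
  | ind i ih =>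
    by_cases hi : IsMin i
    · exact ⟨[], hL, i, by simp, hi⟩
    · obtain ⟨j, hj⟩ := not_isMin_iff.1 hi
      obtain ⟨k, -, hk⟩ := exists_le_covBy_of_lt hj
      obtain ⟨M, hM⟩ := ih k hk.lt (i :: L) (.cons hk hL)
      exact ⟨M ++ [k], by simpa using hM⟩

lemma ncard_topChain_le [Fintype P] : {L : List P | TopChain L ∧ L ≠ []}.ncard ≤
    ∑ L ∈ (finite_maxChain (P := P)).toFinset, L.length := by
  have hsub : {L : List P | TopChain L ∧ L ≠ []} ⊆
      ↑((finite_maxChain (P := P)).toFinset.biUnion fun L =>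
        (Finset.range L.length).image fun k => L.drop k) := by
    rintro L ⟨hL, hne⟩
    obtain ⟨M, hM⟩ := hL.exists_maxChain hne
    simp only [Finset.coe_biUnion, Set.mem_iUnion, Set.Finite.coe_toFinset]
    refine ⟨M ++ L, hM, ?_⟩
    simp only [Finset.coe_image, Set.mem_image, Finset.coe_range, Set.mem_Iio]
    refine ⟨M.length, ?_, by simp⟩
    have := List.length_pos_iff.2 hne
    simp [this]
  refine (Set.ncard_le_ncard hsub (Finset.finite_toSet _)).trans ?_
  rw [Set.ncard_coe_finset]
  refine Finset.card_biUnion_le.trans (Finset.sum_le_sum fun L _ => ?_)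
  exact Finset.card_image_le.trans (by simp)

lemma ncard_orderForms_le [Fintype P] : (orderForms P).ncard ≤ (chainForms P).ncard := by
  rw [ncard_orderForms, ncard_chainForms]
  have h1 : {L : List P | MaxChain L}.ncard =
      ∑ L ∈ (finite_maxChain (P := P)).toFinset, 1 := by
    rw [Finset.sum_const, smul_eq_mul, mul_one, Set.ncard_eq_toFinset_card _ finite_maxChain]
  rw [h1]
  refine (Nat.add_le_add_right ncard_topChain_le _).trans ?_
  rw [← Finset.sum_add_distrib]
  exact Finset.sum_le_sum fun L _ => Nat.lt_two_pow_self

/-! ### Lists versus `RelSeries` -/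

lemma topChain_iff {L : List P} (hne : L ≠ []) :
    TopChain L ↔ L.IsChain (· ⋖ ·) ∧ IsMax (L.getLast hne) := by
  induction L with
  | nil => exact absurd rfl hne
  | cons i L ih =>
    rcases L with _ | ⟨j, L⟩
    · constructor
      · rintro (_ | h)
        exact ⟨.singleton i, h⟩
      · exact fun h => .single h.2
    · have := ih (by simp)
      rw [List.getLast_cons (by simp), List.isChain_cons_cons, and_assoc, ← this]
      constructor
      · rintro (_ | _ | ⟨h, hL⟩)
        exact ⟨h, hL⟩
      · exact fun h => .cons h.1 h.2

lemma topChain_toList_iff {c : SaturatedChain P} : TopChain c.toList ↔ IsMax c.last := by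
  rw [topChain_iff c.toList_ne_nil, RelSeries.getLast_toList]
  exact and_iff_right c.isChain_toList

lemma maxChain_toList_iff {c : SaturatedChain P} : MaxChain c.toList ↔ c.IsMaximal := by
  rw [MaxChain, topChain_toList_iff, SaturatedChain.IsMaximal, and_comm,
    List.head?_eq_some_head c.toList_ne_nil, RelSeries.head_toList]
  simp

lemma exists_toList_eq {L : List P} (hL : TopChain L) (hne : L ≠ []) :
    ∃ c : SaturatedChain P, c.toList = L :=
  ⟨.fromListIsChain L hne ((topChain_iff hne).1 hL).1, RelSeries.toList_fromListIsChain _ _ _⟩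

lemma MaxChain.ne_nil {L : List P} (hL : MaxChain L) : L ≠ [] := by
  rintro rfl
  obtain ⟨i, hi, -⟩ := hL.2
  simp at hi

lemma isMax_last_iff {c : SaturatedChain P} : IsMax c.last ↔ ∃ i ∈ c, IsMax i := by
  refine ⟨fun h => ⟨_, c.last_mem, h⟩, ?_⟩
  rintro ⟨i, hi, hmax⟩
  have hle : i ≤ c.last := by
    obtain ⟨k, rfl⟩ := hi
    exact (Fin.monotone_iff_le_succ.2 fun k => (c.step k).le) (Fin.le_last k)
  exact hle.antisymm (hmax hle) ▸ hmax

lemma sc_eq : sc P = {L : List P | TopChain L ∧ L ≠ []}.ncard := by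
  rw [sc, ← Set.ncard_image_of_injective _ RelSeries.toList_injective]
  congr 1
  ext L
  constructor
  · rintro ⟨c, hc, rfl⟩
    exact ⟨topChain_toList_iff.2 (isMax_last_iff.2 hc), c.toList_ne_nil⟩
  · rintro ⟨hL, hne⟩
    obtain ⟨c, rfl⟩ := exists_toList_eq hL hne
    exact ⟨c, isMax_last_iff.1 (topChain_toList_iff.1 hL), rfl⟩

lemma mc_eq : mc P = {L : List P | MaxChain L}.ncard := by
  rw [mc, ← Set.ncard_image_of_injective _ RelSeries.toList_injective]
  congr 1
  ext L
  constructor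
  · rintro ⟨c, hc, rfl⟩
    exact maxChain_toList_iff.2 hc
  · intro hL
    obtain ⟨c, rfl⟩ := exists_toList_eq hL.1 hL.ne_nil
    exact ⟨c, maxChain_toList_iff.1 hL, rfl⟩

/-- The length of a chain is one less than its number of entries; the truncated subtraction is
harmless since maximal chains are nonempty. -/
lemma mcLength_eq [Fintype P] (ℓ : ℕ) : mcLength P ℓ =
    ((finite_maxChain (P := P)).toFinset.filter fun L => L.length - 1 = ℓ).card := by
  rw [mcLength, ← Set.ncard_image_of_injective _ RelSeries.toList_injective,
    ← Set.ncard_coe_finset]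
  congr 1
  ext L
  simp only [Finset.coe_filter, Set.Finite.mem_toFinset]
  constructor
  · rintro ⟨c, ⟨hc, rfl⟩, rfl⟩
    exact ⟨maxChain_toList_iff.2 hc, by simp⟩
  · rintro ⟨hL, hlen⟩
    obtain ⟨c, rfl⟩ := exists_toList_eq hL.1 (MaxChain.ne_nil hL)
    exact ⟨c, ⟨maxChain_toList_iff.1 hL, by simpa using hlen⟩, rfl⟩

lemma sum_maxChain_eq [Fintype P] :
    ∑ L ∈ (finite_maxChain (P := P)).toFinset, 2 ^ L.length =
      ∑ ℓ ∈ Finset.range (Fintype.card P), 2 ^ (ℓ + 1) * mcLength P ℓ := by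
  rw [← Finset.sum_fiberwise_of_maps_to (g := fun L => L.length - 1)
    (t := Finset.range (Fintype.card P))]
  · refine Finset.sum_congr rfl fun ℓ _ => ?_
    rw [mcLength_eq, mul_comm, ← smul_eq_mul, ← Finset.sum_const]
    refine Finset.sum_congr rfl fun L hL => ?_
    obtain ⟨hL, hlen⟩ := Finset.mem_filter.1 hL
    have hL : MaxChain L := (finite_maxChain.mem_toFinset).1 hL
    have := List.length_pos_iff.2 hL.ne_nil
    congr 1
    omega
  · intro L hL
    have hL : MaxChain L := (finite_maxChain.mem_toFinset).1 hL
    have h1 := List.length_pos_iff.2 hL.ne_nil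
    have h2 := hL.1.nodup.length_le_card
    simp only [Finset.mem_range]
    omega

end

end EnrichedPoset

theorem mainTheorem7 {P : Type*} [PartialOrder P] [Fintype P] [Nonempty P] :
    EnrichedPoset.numFacets (EnrichedPoset.enrichedOrderPolytope P)
        = EnrichedPoset.sc P + EnrichedPoset.mc P ∧
    EnrichedPoset.numFacets (EnrichedPoset.enrichedChainPolytope P)
        = ∑ ℓ ∈ Finset.range (Fintype.card P), 2 ^ (ℓ + 1) * EnrichedPoset.mcLength P ℓ ∧
    EnrichedPoset.numFacets (EnrichedPoset.enrichedOrderPolytope P)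
        ≤ EnrichedPoset.numFacets (EnrichedPoset.enrichedChainPolytope P) := by
  open EnrichedPoset in
  have hO : numFacets (enrichedOrderPolytope P) = (orderForms P).ncard :=
    numFacets_eq_ncard finite_orderForms enrichedOrderPolytope_eq fun _ => span_orderForm_eq
  have hC : numFacets (enrichedChainPolytope P) = (chainForms P).ncard :=
    numFacets_eq_ncard finite_chainForms enrichedChainPolytope_eq fun _ => span_chainForm_eq
  rw [hO, hC]
  exact ⟨by rw [ncard_orderForms, sc_eq, mc_eq], by rw [ncard_chainForms, sum_maxChain_eq],
    ncard_orderForms_le⟩
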